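/- Let $H$ be a finite-dimensional real Hilbert space. Let $f\colon H\to\mathbb{R}$ be convex and differentiable with nonexpansive gradient, i.e. $\|\nabla f(x)-\nabla f(y)\|\le\|x-y\|$ for all $x,y\in H$, and let $g\colon H\to\left]-\infty,+\infty\right]$ be convex, lower semicontinuous and proper. Set $A=\nabla f$ and $B=\partial g$, where $\partial g(x)=\{u\in H : g(y)\ge g(x)+\langle u,y-x\rangle\ \text{for all } y\in H\}$. Let $J_B=(\mathrm{Id}+B)^{-1}$ be the resolvent of $B$ and let $T_{\mathrm{FB}}=J_B(\mathrm{Id}-A)$ be the forward-backward operator. For a function $h$ on $H$ write $\operatorname{dom}h=\{x: h(x)<+\infty\}$ and $h^*(x)=\sup_{u\in H}(\langle x,u\rangle-h(u))$. For subsets $C,D$ of $H$ write $C\simeq D$ ("nearly equal") if $\overline{C}=\overline{D}$ and $\operatorname{ri}C=\operatorname{ri}D$, where $\operatorname{ri}$ denotes the interior relative to the affine hull. Then $T_{\mathrm{FB}}$ is a well-defined single-valued map $H\to H$, and $$\operatorname{ran}(\mathrm{Id}-T_{\mathrm{FB}})\simeq\operatorname{dom}f^*+\operatorname{dom}g^*.$$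 If in addition $g=\iota_V$ for a nonempty closed convex subset $V$ of $H$ (that is, $g=0$ on $V$ and $g=+\infty$ outside $V$), then $$\operatorname{ran}(\mathrm{Id}-T_{\mathrm{FB}})\simeq\operatorname{dom}f^*+(\operatorname{rec}V)^{\ominus},$$ where $\operatorname{rec}V=\{x\in H: x+V\subseteq V\}$ and $C^{\ominus}=\{u\in H: \langle c,u\rangle\le 0\ \text{for all } c\in C\}$. -/

import Mathlib

open Set
open scoped Pointwise RealInnerProductSpace

noncomputable section

namespace ConvexFB

variable {H : Type*} [NormedAddCommGroup H] [InnerProductSpace ℝ H]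

/-- The epigraph of an extended-real-valued function. -/
def epigraph (g : H → EReal) : Set (H × ℝ) :=
  {p | g p.1 ≤ (p.2 : EReal)}

/-- An extended-real-valued function is convex if its epigraph is convex. -/
def IsConvexFun (g : H → EReal) : Prop :=
  Convex ℝ (epigraph g)

/-- A function is proper if it never takes the value `-∞` and is not identically `+∞`. -/
def IsProperFun (g : H → EReal) : Prop :=
  (∀ x, g x ≠ ⊥) ∧ ∃ x, g x ≠ ⊤

/-- The effective domain `dom g`. -/
def effDomain (g : H → EReal) : Set H :=
  {x | g x < ⊤}

/-- The Fenchel conjugate `g* (x) = sup_u (⟨x, u⟩ - g u)`. -/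
def fenchelConj (g : H → EReal) : H → EReal :=
  fun x => ⨆ u : H, ((⟪x, u⟫ : ℝ) : EReal) - g u

/-- The subdifferential `∂g`, a set-valued operator:
`u ∈ ∂g x` iff `g y ≥ g x + ⟨u, y - x⟩` for all `y`. -/
def subdiff (g : H → EReal) : H → Set H :=
  fun x => {u | ∀ y : H, g x + ((⟪u, y - x⟫ : ℝ) : EReal) ≤ g y}

/-- The set-valued operator `Id + B`. -/
def idAdd (B : H → Set H) : H → Set H :=
  fun p => {p} + B p

/-- The inverse of a set-valued operator. -/
def opInv (B : H → Set H) : H → Set H :=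
  fun x => {p | x ∈ B p}

/-- The resolvent `J_B = (Id + B)⁻¹` of a set-valued operator. -/
def opResolvent (B : H → Set H) : H → Set H :=
  opInv (idAdd B)

/-- The forward-backward operator `T_FB = J_B (Id - A)`, with `A` single-valued. -/
def forwardBackward (A : H → H) (B : H → Set H) : H → Set H :=
  fun x => opResolvent B (x - A x)

/-- The range `ran (Id - T)` of the displacement operator of `T`. -/
def displacementRange (T : H → Set H) : Set H :=
  ⋃ x : H, {x} - T x

/-- Near equality: equal closures and equal relative interiors. -/
def NearlyEqual (C D : Set H) : Prop :=
  closure C = closure D ∧ intrinsicInterior ℝ C = intrinsicInterior ℝ D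

open Classical in
/-- The indicator function `ι_V`: zero on `V` and `+∞` outside `V`. -/
def indicatorFun (V : Set H) : H → EReal :=
  fun x => if x ∈ V then 0 else ⊤

/-- The recession cone `rec V = {x | x + V ⊆ V}`. -/
def recessionCone (V : Set H) : Set H :=
  {x | ∀ v ∈ V, x + v ∈ V}

/-- The polar cone `C^⊖ = {u | ⟨c, u⟩ ≤ 0 for all c ∈ C}`. -/
def polarCone (C : Set H) : Set H :=
  {u | ∀ c ∈ C, ⟪c, u⟫ ≤ 0}

end ConvexFB

end

namespace ConvexFB

/-! ### Epigraphs of extended-real-valued functions -/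

section Epigraph

variable {H : Type*}

/-! Unfolding the resolvent, `y` lies in the displacement range iff `y - ∇f x ∈ ∂g (x - y)` for some
`x`. Gradients and subgradients are slopes of affine minorants, that is, points of `dom f*` and `dom
g*`, so the range lies in the convex set `D = dom f* + dom g*`.

Conversely, let `y ∈ ri D`. Tilting `f` to `ψ x = f (x + y) - ⟪y, x⟫` moves `y` to the origin. As
`0` is then relatively interior to the sum of slope sets, `ψ + g` has compact sublevel sets along
the span of that sum, and projecting onto the span never increases it. So it has a minimizer `p`
(`exists_isMinimizer_add`), and Fermat's rule there gives the inclusion with `x = p + y`. A set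
between `ri D` and `closure D` is nearly equal to `D` (`nearlyEqual_of_subset_closure`).

For `g = ι_V`, `dom g*` is the barrier cone of `V`, which by separation is dense in the polar of
`rec V`; the same sandwich applies. -/

theorem mem_epigraph_coe {f : H → ℝ} {p : H × ℝ} :
    p ∈ epigraph (fun x => (f x : EReal)) ↔ f p.1 ≤ p.2 :=
  EReal.coe_le_coe_iff

theorem epigraph_mono_right {g : H → EReal} {x : H} {s t : ℝ} (h : (x, s) ∈ epigraph g)
    (hst : s ≤ t) : (x, t) ∈ epigraph g :=
  le_trans (show g x ≤ s from h) (EReal.coe_le_coe_iff.2 hst)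

theorem isClosed_epigraph [TopologicalSpace H] {g : H → EReal} (hg : LowerSemicontinuous g) :
    IsClosed (epigraph g) :=
  hg.isClosed_epigraph.preimage
    (continuous_fst.prodMk (continuous_coe_real_ereal.comp continuous_snd))

theorem IsProperFun.nonempty_epigraph {g : H → EReal} (hg : IsProperFun g) :
    (epigraph g).Nonempty :=
  let ⟨x, hx⟩ := hg.2
  ⟨(x, (g x).toReal), (EReal.coe_toReal hx (hg.1 x)).ge⟩

end Epigraph

/-! ### Affine minorants and subgradients -/

section Slopes

variable {H : Type*} [NormedAddCommGroup H] [InnerProductSpace ℝ H]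

/-- The slopes of the affine functions on `H` whose graph lies below the set `E`. -/
def minorantSlopes (E : Set (H × ℝ)) : Set H :=
  {b | ∃ c : ℝ, ∀ p ∈ E, ⟪b, p.1⟫ - c ≤ p.2}

theorem convex_minorantSlopes (E : Set (H × ℝ)) : Convex ℝ (minorantSlopes E) := by
  rintro a ⟨c, hc⟩ b ⟨d, hd⟩ s t hs ht hst
  refine ⟨s * c + t * d, fun p hp => ?_⟩
  have h1 := mul_le_mul_of_nonneg_left (hc p hp) hs
  have h2 := mul_le_mul_of_nonneg_left (hd p hp) ht
  have h3 : p.2 = s * p.2 + t * p.2 := by rw [← add_mul, hst, one_mul]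
  rw [inner_add_left, real_inner_smul_left, real_inner_smul_left]
  linarith

/-- A real upper bound `c` of the conjugate at `b` is exactly an offset for an affine minorant of
slope `b`. This trades `EReal` suprema for real inequalities. -/
theorem mem_effDomain_fenchelConj_iff {g : H → EReal} (hg : ∀ x, g x ≠ ⊥) {b : H} :
    b ∈ effDomain (fenchelConj g) ↔ b ∈ minorantSlopes (epigraph g) := by
  constructor
  · intro h
    obtain ⟨c, hc, -⟩ := EReal.lt_iff_exists_real_btwn.1 (show fenchelConj g b < ⊤ from h)
    refine ⟨c, fun p hp => ?_⟩
    have h1 : ((⟪b, p.1⟫ : ℝ) : EReal) - g p.1 ≤ c :=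
      (le_iSup (fun u : H => ((⟪b, u⟫ : ℝ) : EReal) - g u) p.1).trans hc.le
    have h2 : g p.1 ≤ p.2 := hp
    have h3 : g p.1 ≠ ⊤ := ne_top_of_le_ne_top (EReal.coe_ne_top _) h2
    lift g p.1 to ℝ using ⟨h3, hg _⟩ with r
    norm_cast at h1 h2
    linarith
  · rintro ⟨c, hc⟩
    refine lt_of_le_of_lt (iSup_le fun u => ?_) (EReal.coe_lt_top c)
    rcases eq_or_ne (g u) ⊤ with h | h
    · simp [h]
    · obtain ⟨r, hr⟩ : ∃ r : ℝ, (r : EReal) = g u := ⟨_, EReal.coe_toReal h (hg u)⟩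
      have := hc (u, r) hr.ge
      rw [← hr]
      norm_cast
      simp only at this
      linarith

theorem mem_minorantSlopes_coe {f : H → ℝ} {b : H} :
    b ∈ minorantSlopes (epigraph fun x => (f x : EReal)) ↔ ∃ c : ℝ, ∀ x, ⟪b, x⟫ - c ≤ f x :=
  exists_congr fun _ => ⟨fun h x => h (x, f x) (mem_epigraph_coe.2 le_rfl),
    fun h p hp => (h p.1).trans (mem_epigraph_coe.1 hp)⟩

/-- Every subgradient is the slope of an affine minorant. -/
theorem mem_minorantSlopes_of_mem_subdiff {g : H → EReal} (hg : IsProperFun g) {x u : H}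
    (hu : u ∈ subdiff g x) : u ∈ minorantSlopes (epigraph g) ∧ g x ≠ ⊤ := by
  have htop : g x ≠ ⊤ := by
    intro h
    obtain ⟨y, hy⟩ := hg.2
    have := hu y
    rw [h, EReal.top_add_coe, top_le_iff] at this
    exact hy this
  refine ⟨⟨⟪u, x⟫ - (g x).toReal, fun p hp => ?_⟩, htop⟩
  have h1 := (hu p.1).trans (show g p.1 ≤ p.2 from hp)
  rw [← EReal.coe_toReal htop (hg.1 x)] at h1
  norm_cast at h1
  rw [inner_sub_right] at h1
  linarith

/-- The subdifferential of a proper function is monotone. -/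
theorem inner_sub_nonneg_of_mem_subdiff {g : H → EReal} (hg : IsProperFun g) {x y u v : H}
    (hu : u ∈ subdiff g x) (hv : v ∈ subdiff g y) : 0 ≤ ⟪u - v, x - y⟫ := by
  have hx := (mem_minorantSlopes_of_mem_subdiff hg hu).2
  have hy := (mem_minorantSlopes_of_mem_subdiff hg hv).2
  have h1 := hu y
  have h2 := hv x
  rw [← EReal.coe_toReal hx (hg.1 x), ← EReal.coe_toReal hy (hg.1 y)] at h1 h2
  norm_cast at h1 h2
  rw [← neg_sub, inner_neg_right] at h1
  rw [inner_sub_left]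
  linarith

end Slopes

/-! ### Separation of epigraphs -/

section Separation

variable {H : Type*} [NormedAddCommGroup H] [InnerProductSpace ℝ H] [CompleteSpace H]

/-- A point outside a closed convex epigraph is separated from it by a vertical hyperplane or by
the graph of an affine minorant. -/
theorem exists_separation_epigraph {g : H → EReal} (hconv : IsConvexFun g)
    (hclosed : IsClosed (epigraph g)) (hne : (epigraph g).Nonempty) {x : H} {r : ℝ}
    (hx : (x, r) ∉ epigraph g) :
    (∃ (v : H) (α : ℝ), (∀ p ∈ epigraph g, ⟪v, p.1⟫ < α) ∧ α < ⟪v, x⟫) ∨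
      ∃ (b : H) (c : ℝ), (∀ p ∈ epigraph g, ⟪b, p.1⟫ - c ≤ p.2) ∧ r < ⟪b, x⟫ - c := by
  obtain ⟨F, α, h1, h2⟩ := geometric_hahn_banach_closed_point hconv hclosed hx
  set v : H := (InnerProductSpace.toDual ℝ H).symm (F.comp (ContinuousLinearMap.inl ℝ H ℝ))
  set l : ℝ := F (0, 1)
  have hF : ∀ (y : H) (s : ℝ), F (y, s) = ⟪v, y⟫ + l * s := by
    intro y s
    have h3 : ((y, s) : H × ℝ) = (y, 0) + s • (0, 1) := by simp
    rw [h3, map_add, map_smul]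
    simp [v, l, mul_comm]
  rw [hF] at h2
  replace h1 : ∀ p ∈ epigraph g, ⟪v, p.1⟫ + l * p.2 < α := fun p hp => by
    rw [← hF]; exact h1 p hp
  -- The epigraph is unbounded upwards, so a positive vertical coefficient would violate the bound
  -- `α`.
  have hl : l ≤ 0 := by
    by_contra! hl
    obtain ⟨⟨y, s⟩, hy⟩ := hne
    have h3 := h1 (y, max s ((α - ⟪v, y⟫) / l)) (epigraph_mono_right hy (le_max_left _ _))
    have h4 := mul_le_mul_of_nonneg_left (le_max_right s ((α - ⟪v, y⟫) / l)) hl.le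
    rw [mul_div_cancel₀ _ hl.ne'] at h4
    simp only at h3
    linarith
  rcases hl.eq_or_lt with hl | hl
  · left
    refine ⟨v, α, fun p hp => ?_, ?_⟩
    · simpa [hl] using h1 p hp
    · simpa [hl] using h2
  · right
    have hm : 0 < -l := by linarith
    have key : ∀ y : H, ⟪(-l)⁻¹ • v, y⟫ - (-l)⁻¹ * α = (-l)⁻¹ * (⟪v, y⟫ - α) := fun y => by
      rw [real_inner_smul_left]; ring
    refine ⟨(-l)⁻¹ • v, (-l)⁻¹ * α, fun p hp => ?_, ?_⟩
    · rw [key, inv_mul_le_iff₀ hm]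
      linarith [h1 p hp]
    · rw [key, lt_inv_mul_iff₀ hm]
      linarith

/-- A proper lower semicontinuous convex function has an affine minorant. -/
theorem nonempty_minorantSlopes_epigraph {g : H → EReal} (hconv : IsConvexFun g)
    (hlsc : LowerSemicontinuous g) (hg : IsProperFun g) :
    (minorantSlopes (epigraph g)).Nonempty := by
  obtain ⟨x, hx⟩ := hg.2
  have hmem : (x, (g x).toReal) ∈ epigraph g := (EReal.coe_toReal hx (hg.1 x)).ge
  have hnot : (x, (g x).toReal - 1) ∉ epigraph g := fun h => by
    have h1 : g x ≤ (((g x).toReal - 1 : ℝ) : EReal) := h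
    rw [← EReal.coe_toReal hx (hg.1 x)] at h1
    norm_cast at h1
    rw [EReal.toReal_coe] at h1
    linarith
  rcases exists_separation_epigraph hconv (isClosed_epigraph hlsc) ⟨_, hmem⟩ hnot with
    ⟨v, α, h1, h2⟩ | ⟨b, c, h1, -⟩
  · exact absurd (h1 _ hmem) h2.not_gt
  · exact ⟨b, c, h1⟩

/-- A closed convex function is affine in the directions orthogonal to all differences of slopes
of affine minorants. -/
theorem add_mem_epigraph_of_orthogonal {g : H → EReal} (hconv : IsConvexFun g)
    (hclosed : IsClosed (epigraph g)) {b w x : H} {s : ℝ} (hb : b ∈ minorantSlopes (epigraph g))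
    (hw : ∀ a ∈ minorantSlopes (epigraph g), ⟪a, w⟫ = ⟪b, w⟫) (hx : (x, s) ∈ epigraph g) :
    (x + w, s + ⟪b, w⟫) ∈ epigraph g := by
  by_contra hnot
  rcases exists_separation_epigraph hconv hclosed ⟨_, hx⟩ hnot with
    ⟨v, α, h1, h2⟩ | ⟨a, c, h1, h2⟩
  · obtain ⟨c, hc⟩ := hb
    -- Since `v` is bounded by `α` on the domain, `b + v` is again a slope; hence `⟪v, w⟫ = 0`, and
    -- `v` cannot separate `x + w` from `x`.
    have h3 := hw (b + v) ⟨c + α, fun p hp => by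
      have := hc p hp
      have := h1 p hp
      rw [inner_add_left]
      linarith⟩
    have h4 := h1 _ hx
    rw [inner_add_left] at h3
    rw [inner_add_right] at h2
    simp only at h4
    linarith
  · have h3 := hw a ⟨c, h1⟩
    have h4 := h1 _ hx
    rw [inner_add_right] at h2
    simp only at h4
    linarith

end Separation

/-! ### Gradient inequality and Fermat's rule -/

section Gradient

variable {H : Type*} [NormedAddCommGroup H] [InnerProductSpace ℝ H] [CompleteSpace H]

/-- Right difference quotients along `d` are at least `k`; pass to the limit. -/
theorem le_inner_gradient_of_forall_le {f : H → ℝ} {x v d : H} {k : ℝ} (hf : HasGradientAt f v x)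
    (h : ∀ t ∈ Ioc (0 : ℝ) 1, f x + t * k ≤ f (x + t • d)) : k ≤ ⟪v, d⟫ := by
  have hline : HasDerivAt (fun t : ℝ => x + t • d) d 0 := by
    simpa using ((hasDerivAt_id (0 : ℝ)).smul_const d).const_add x
  have hf' : HasFDerivAt f (InnerProductSpace.toDual ℝ H v) (x + (0 : ℝ) • d) := by
    simpa using hf.hasFDerivAt
  have hderiv : HasDerivAt (fun t : ℝ => f (x + t • d)) ⟪v, d⟫ 0 := by
    simpa [Function.comp_def] using hf'.comp_hasDerivAt (0 : ℝ) hline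
  have htends := hderiv.tendsto_slope_zero_right
  refine ge_of_tendsto htends ?_
  filter_upwards [Ioc_mem_nhdsGT (zero_lt_one' ℝ)] with t ht
  have := h t ht
  simp only [zero_add, zero_smul, add_zero, smul_eq_mul]
  rw [le_inv_mul_iff₀ ht.1]
  linarith

/-- The gradient inequality for convex functions. -/
theorem add_inner_gradient_le {f : H → ℝ} (hf : ConvexOn ℝ univ f) {x v : H}
    (hv : HasGradientAt f v x) (y : H) : f x + ⟪v, y - x⟫ ≤ f y := by
  have hneg : HasGradientAt (fun z => -f z) (-v) x := by
    rw [hasGradientAt_iff_hasFDerivAt, map_neg]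
    exact hv.hasFDerivAt.neg
  have := le_inner_gradient_of_forall_le (d := y - x) (k := -(f y - f x)) hneg fun t ht => by
    have h1 := hf.2 (mem_univ x) (mem_univ y) (sub_nonneg.2 ht.2) ht.1.le (by ring)
    have h2 : (1 - t) • x + t • y = x + t • (y - x) := by module
    rw [h2] at h1
    simp only [smul_eq_mul] at h1
    linarith
  rw [inner_neg_left] at this
  linarith

theorem gradient_mem_minorantSlopes {f : H → ℝ} (hf : ConvexOn ℝ univ f) {x v : H}
    (hv : HasGradientAt f v x) : v ∈ minorantSlopes (epigraph fun x => (f x : EReal)) :=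
  mem_minorantSlopes_coe.2 ⟨⟪v, x⟫ - f x, fun y => by
    have := add_inner_gradient_le hf hv y
    rw [inner_sub_right] at this
    linarith⟩

/-- Fermat's rule for the sum of a differentiable function and a convex function. -/
theorem neg_gradient_mem_subdiff {f : H → ℝ} {g : H → EReal} (hconv : IsConvexFun g)
    (hg : ∀ x, g x ≠ ⊥) {x v : H} {s : ℝ} (hv : HasGradientAt f v x) (hx : (x, s) ∈ epigraph g)
    (hmin : ∀ p ∈ epigraph g, f x + s ≤ f p.1 + p.2) : -v ∈ subdiff g x := by
  intro y
  rcases eq_or_ne (g y) ⊤ with hy | hy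
  · simp [hy]
  obtain ⟨t, ht⟩ : ∃ t : ℝ, (t : EReal) = g y := ⟨_, EReal.coe_toReal hy (hg y)⟩
  have h1 : s - t ≤ ⟪v, y - x⟫ := le_inner_gradient_of_forall_le hv fun l hl => by
    have h2 := hconv hx (show (y, t) ∈ epigraph g from ht.ge) (sub_nonneg.2 hl.2) hl.1.le (by ring)
    have h3 := hmin _ h2
    have h4 : (1 - l) • x + l • y = x + l • (y - x) := by module
    simp only [Prod.fst_add, Prod.smul_fst, Prod.snd_add, Prod.smul_snd, h4, smul_eq_mul] at h3
    linarith
  calc g x + ((⟪-v, y - x⟫ : ℝ) : EReal) ≤ (s : EReal) + ((⟪-v, y - x⟫ : ℝ) : EReal) := by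
        gcongr; exact hx
    _ ≤ g y := by
        rw [← ht, ← EReal.coe_add, EReal.coe_le_coe_iff, inner_neg_left]
        linarith

end Gradient

/-! ### Resolvents and the displacement range -/

section Operators

variable {H : Type*} [NormedAddCommGroup H]

theorem mem_opResolvent_iff {B : H → Set H} {z p : H} : p ∈ opResolvent B z ↔ z - p ∈ B p := by
  change z ∈ {p} + B p ↔ _
  rw [singleton_add, mem_image]
  exact ⟨fun ⟨u, hu, h⟩ => by rwa [← h, add_sub_cancel_left], fun h => ⟨_, h, by abel⟩⟩

theorem mem_displacementRange_forwardBackward_iff {A : H → H} {B : H → Set H} {y : H} :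
    y ∈ displacementRange (forwardBackward A B) ↔ ∃ x, y - A x ∈ B (x - y) := by
  rw [displacementRange, mem_iUnion]
  refine exists_congr fun x => ?_
  rw [singleton_sub, mem_image]
  have h : ∀ p, p ∈ forwardBackward A B x ↔ x - A x - p ∈ B p := fun p => mem_opResolvent_iff
  constructor
  · rintro ⟨p, hp, rfl⟩
    rw [sub_sub_cancel, sub_right_comm]
    exact (h p).1 hp
  · refine fun hy => ⟨x - y, (h _).2 ?_, sub_sub_cancel x y⟩
    rwa [show x - A x - (x - y) = y - A x by abel]

end Operators

/-! ### Existence of minimizers and the resolvent -/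

section Existence

variable {H : Type*} [NormedAddCommGroup H] [InnerProductSpace ℝ H] [FiniteDimensional ℝ H]

/-- A subset of a finite-dimensional subspace on which the functionals from a ball of that
subspace are bounded is bounded. -/
theorem exists_norm_le_of_forall_inner_le (S : Submodule ℝ H) {K : Set H} (hKS : K ⊆ S) {ε : ℝ}
    (hε : 0 < ε) (hK : ∀ s ∈ S, ‖s‖ ≤ ε → ∃ c : ℝ, ∀ x ∈ K, ⟪s, x⟫ ≤ c) :
    ∃ M : ℝ, ∀ x ∈ K, ‖x‖ ≤ M := by
  let e := stdOrthonormalBasis ℝ S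
  -- Testing with `±ε • e i` bounds each coordinate.
  have hbound : ∀ i, ∃ c : ℝ, ∀ x ∈ K, |⟪(e i : H), x⟫| ≤ c := by
    intro i
    have hnorm : ‖(e i : H)‖ = 1 := e.orthonormal.1 i
    obtain ⟨c, hc⟩ := hK (ε • (e i : H)) (S.smul_mem _ (e i).2)
      (by rw [norm_smul, hnorm, Real.norm_of_nonneg hε.le, mul_one])
    obtain ⟨d, hd⟩ := hK (-(ε • (e i : H))) (S.neg_mem (S.smul_mem _ (e i).2))
      (by rw [norm_neg, norm_smul, hnorm, Real.norm_of_nonneg hε.le, mul_one])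
    refine ⟨max c d / ε, fun x hx => ?_⟩
    have h1 := hc x hx
    have h2 := hd x hx
    rw [inner_neg_left] at h2
    rw [real_inner_smul_left] at h1 h2
    rw [abs_le, le_div_iff₀ hε, ← neg_div, div_le_iff₀ hε]
    constructor
    · linarith [le_max_right c d]
    · linarith [le_max_left c d]
  choose c hc using hbound
  refine ⟨∑ i, c i, fun x hx => ?_⟩
  have hsum := e.sum_repr' ⟨x, hKS hx⟩
  calc ‖x‖ = ‖(⟨x, hKS hx⟩ : S)‖ := rfl
    _ ≤ ∑ i, ‖⟪e i, (⟨x, hKS hx⟩ : S)⟫ • e i‖ := by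
        conv_lhs => rw [← hsum]
        exact norm_sum_le _ _
    _ ≤ ∑ i, c i := Finset.sum_le_sum fun i _ => by
        rw [norm_smul, e.orthonormal.1 i, mul_one]
        exact hc i x hx

/-- If `0` is a relative interior point of `dom f* + dom g*` then `f + g` has a minimizer. -/
theorem exists_isMinimizer_add [CompleteSpace H] {f : H → ℝ} (hf : ConvexOn ℝ univ f)
    (hdiff : Differentiable ℝ f) {g : H → EReal} (hconv : IsConvexFun g)
    (hclosed : IsClosed (epigraph g)) (hne : (epigraph g).Nonempty) (S : Submodule ℝ H)
    (hS : minorantSlopes (epigraph fun x => (f x : EReal)) + minorantSlopes (epigraph g) ⊆ S)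
    {ε : ℝ} (hε : 0 < ε)
    (hball : ∀ s ∈ S, ‖s‖ ≤ ε →
      s ∈ minorantSlopes (epigraph fun x => (f x : EReal)) + minorantSlopes (epigraph g)) :
    ∃ p ∈ epigraph g, ∀ q ∈ epigraph g, f p.1 + p.2 ≤ f q.1 + q.2 := by
  obtain ⟨a, ha, b, hb, hab⟩ := hball 0 S.zero_mem (by simpa using hε.le)
  simp only at hab
  -- Remove the component `z` of `x` orthogonal to `S`. Along `z`, `g` is affine with slope `b`, and
  -- `∇f y + b ∈ S` is orthogonal to `z`, so the gradient inequality at `y` offsets the change in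
  -- `g`.
  have hshift : ∀ q ∈ epigraph g, ∃ q' ∈ epigraph g, q'.1 ∈ S ∧ f q'.1 + q'.2 ≤ f q.1 + q.2 := by
    rintro ⟨x, s⟩ hx
    obtain ⟨y, hy, z, hz, hyz⟩ := S.exists_add_mem_mem_orthogonal x
    have horth : ∀ u ∈ S, ⟪u, -z⟫ = 0 := fun u hu => by
      rw [inner_neg_right, (Submodule.mem_orthogonal S z).1 hz u hu, neg_zero]
    have hxy : x + -z = y := by rw [hyz]; abel
    have hab' : ⟪a, -z⟫ + ⟪b, -z⟫ = 0 := by rw [← inner_add_left, hab, inner_zero_left]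
    have h1 := add_mem_epigraph_of_orthogonal (w := -z) hconv hclosed hb (fun b' hb' => by
      have := horth _ (hS (add_mem_add ha hb'))
      rw [inner_add_left] at this
      linarith) hx
    refine ⟨_, h1, by rw [hxy]; exact hy, ?_⟩
    have hgrad := (hdiff y).hasGradientAt
    have h2 := add_inner_gradient_le hf hgrad x
    have h3 := horth _ (hS (add_mem_add (gradient_mem_minorantSlopes hf hgrad) hb))
    have h4 : x - y = -(-z) := by rw [hyz]; abel
    rw [inner_add_left] at h3
    rw [h4, inner_neg_right] at h2
    simp only [hxy]
    linarith
  obtain ⟨q₀, hq₀, hq₀S, -⟩ := hshift _ hne.some_mem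
  set r := f q₀.1 + q₀.2
  have hcont : Continuous fun p : H × ℝ => f p.1 + p.2 :=
    (hdiff.continuous.comp continuous_fst).add continuous_snd
  set K : Set (H × ℝ) := epigraph g ∩ (Prod.fst ⁻¹' (S : Set H) ∩ {p | f p.1 + p.2 ≤ r})
  have hKclosed : IsClosed K := hclosed.inter
    ((S.closed_of_finiteDimensional.preimage continuous_fst).inter
      (isClosed_le hcont continuous_const))
  obtain ⟨c, hc⟩ := mem_minorantSlopes_coe.1 ha
  obtain ⟨d, hd⟩ := hb
  -- Each small `s ∈ S` splits as a sum of slopes, so `⟪s, ·⟫` is at most `f + g` plus a constant,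
  -- hence bounded above on the sublevel set.
  obtain ⟨M, hM⟩ : ∃ M : ℝ, ∀ x ∈ Prod.fst '' K, ‖x‖ ≤ M := by
    refine exists_norm_le_of_forall_inner_le S ?_ hε fun s hs hsε => ?_
    · rintro _ ⟨p, hp, rfl⟩
      exact hp.2.1
    · obtain ⟨a', ha', b', ⟨d', hd'⟩, rfl⟩ := hball s hs hsε
      obtain ⟨c', hc'⟩ := mem_minorantSlopes_coe.1 ha'
      refine ⟨r + c' + d', ?_⟩
      rintro _ ⟨p, hp, rfl⟩
      have h1 := hc' p.1
      have h2 := hd' p hp.1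
      have h3 : f p.1 + p.2 ≤ r := hp.2.2
      rw [inner_add_left]
      linarith
  have hKcompact : IsCompact K := by
    refine (((isCompact_closedBall (0 : H) M).prod
      (isCompact_Icc (a := -(‖b‖ * M) - d) (b := r + ‖a‖ * M + c)))).of_isClosed_subset hKclosed ?_
    intro p hp
    have hpM := hM _ (mem_image_of_mem _ hp)
    have h1 := (neg_le_of_abs_le (abs_real_inner_le_norm a p.1))
    have h2 := (neg_le_of_abs_le (abs_real_inner_le_norm b p.1))
    have h3 := mul_le_mul_of_nonneg_left hpM (norm_nonneg a)
    have h4 := mul_le_mul_of_nonneg_left hpM (norm_nonneg b)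
    have h5 := hc p.1
    have h6 := hd p hp.1
    have h7 : f p.1 + p.2 ≤ r := hp.2.2
    refine ⟨by simpa using hpM, ?_, ?_⟩ <;> linarith
  obtain ⟨p, hp, hmin⟩ := hKcompact.exists_isMinOn ⟨q₀, hq₀, hq₀S, le_refl r⟩ hcont.continuousOn
  refine ⟨p, hp.1, fun q hq => ?_⟩
  obtain ⟨q', hq', hq'S, hle⟩ := hshift q hq
  refine le_trans ?_ hle
  rcases le_total (f q'.1 + q'.2) r with h | h
  · exact hmin ⟨hq', hq'S, h⟩
  · exact le_trans hp.2.2 h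

/-- If `0` is a relative interior point of `dom f* + dom g*` then `∇f + ∂g` has a zero. -/
theorem exists_neg_gradient_mem_subdiff [CompleteSpace H] {f : H → ℝ} (hf : ConvexOn ℝ univ f)
    (hdiff : Differentiable ℝ f) {g : H → EReal} (hconv : IsConvexFun g)
    (hlsc : LowerSemicontinuous g) (hg : IsProperFun g) (S : Submodule ℝ H)
    (hS : minorantSlopes (epigraph fun x => (f x : EReal)) + minorantSlopes (epigraph g) ⊆ S)
    {ε : ℝ} (hε : 0 < ε)
    (hball : ∀ s ∈ S, ‖s‖ ≤ ε →
      s ∈ minorantSlopes (epigraph fun x => (f x : EReal)) + minorantSlopes (epigraph g)) :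
    ∃ x, -gradient f x ∈ subdiff g x := by
  obtain ⟨p, hp, hmin⟩ := exists_isMinimizer_add hf hdiff hconv (isClosed_epigraph hlsc)
    hg.nonempty_epigraph S hS hε hball
  exact ⟨p.1, neg_gradient_mem_subdiff hconv hg.1 (hdiff p.1).hasGradientAt hp hmin⟩

/-- The resolvent of the subdifferential of a proper lower semicontinuous convex function is
single-valued with full domain. -/
theorem existsUnique_mem_opResolvent_subdiff [CompleteSpace H] {g : H → EReal}
    (hconv : IsConvexFun g) (hlsc : LowerSemicontinuous g) (hg : IsProperFun g) (z : H) :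
    ∃! p, p ∈ opResolvent (subdiff g) z := by
  simp_rw [mem_opResolvent_iff]
  refine existsUnique_of_exists_of_unique ?_ fun p q hp hq => ?_
  -- The resolvent point is the proximal point, the minimizer of `f + g`. The slopes of this `f`
  -- fill `H`, so the existence result applies with `S = ⊤`.
  · set f : H → ℝ := fun x => (1 / 2) * ‖x - z‖ ^ 2
    have hgrad : ∀ x, HasGradientAt f (x - z) x := fun x => by
      rw [hasGradientAt_iff_hasFDerivAt]
      refine ((((hasFDerivAt_id x).sub_const z).norm_sq).const_mul (1 / 2)).congr_fderiv ?_
      ext v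
      simp
    have hf : ConvexOn ℝ univ f := by
      refine ((((convexOn_norm convex_univ).translate_left (-z)).pow ?_ 2).smul
        (by norm_num : (0 : ℝ) ≤ 1 / 2)).congr ?_
      · intro x _
        exact norm_nonneg _
      · intro x _
        simp [f, sub_eq_add_neg]
    have huniv : minorantSlopes (epigraph fun x => (f x : EReal)) = univ := by
      refine eq_univ_of_forall fun a => ?_
      simpa using gradient_mem_minorantSlopes hf (hgrad (a + z))
    obtain ⟨b, hb⟩ := nonempty_minorantSlopes_epigraph hconv hlsc hg
    obtain ⟨x, hx⟩ := exists_neg_gradient_mem_subdiff hf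
      (fun x => (hgrad x).differentiableAt) hconv hlsc hg ⊤ (by simp) one_pos
      fun s _ _ => ⟨s - b, by rw [huniv]; trivial, b, hb, sub_add_cancel s b⟩
    refine ⟨x, ?_⟩
    rwa [(hgrad x).gradient, neg_sub] at hx
  · have h := inner_sub_nonneg_of_mem_subdiff hg hp hq
    rw [show z - p - (z - q) = -(p - q) by abel, inner_neg_left, real_inner_self_eq_norm_sq] at h
    exact sub_eq_zero.1 (norm_eq_zero.1 (pow_eq_zero_iff two_ne_zero |>.1
      (le_antisymm (by linarith) (sq_nonneg _))))

end Existence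

/-! ### Relative interiors and near equality -/

section NearEquality

variable {H : Type*} [NormedAddCommGroup H] [InnerProductSpace ℝ H]

/-- A nonempty set is the isometric image of a set in a subspace that spans this subspace
affinely. -/
theorem exists_affineIsometry_image_eq {D : Set H} (hD : D.Nonempty) :
    ∃ (S : Submodule ℝ H) (x : H) (φ : S →ᵃⁱ[ℝ] H), (∀ s, φ s = x + s) ∧
      φ '' (φ ⁻¹' D) = D ∧ affineSpan ℝ (φ ⁻¹' D) = ⊤ := by
  obtain ⟨x, hx⟩ := hD
  set S := (affineSpan ℝ D).direction
  set φ : S →ᵃⁱ[ℝ] H :=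
    (AffineIsometryEquiv.constVAdd ℝ H x).toAffineIsometry.comp S.subtypeₗᵢ.toAffineIsometry
  have hφ : ∀ s, φ s = x + s := fun s => rfl
  have hxD : x ∈ affineSpan ℝ D := subset_affineSpan ℝ D hx
  have himage : φ '' (φ ⁻¹' D) = D := by
    rw [image_preimage_eq_iff]
    intro y hy
    exact ⟨⟨y - x, AffineSubspace.vsub_mem_direction (subset_affineSpan ℝ D hy) hxD⟩,
      by simp [hφ]⟩
  refine ⟨S, x, φ, hφ, himage, ?_⟩
  refine eq_top_iff.2 fun s _ => ?_
  have h1 : φ s ∈ affineSpan ℝ (φ '' (φ ⁻¹' D)) := by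
    rw [himage, hφ, add_comm]
    exact AffineSubspace.vadd_mem_of_mem_direction s.2 hxD
  have h2 : affineSpan ℝ (φ '' (φ ⁻¹' D)) = (affineSpan ℝ (φ ⁻¹' D)).map φ.toAffineMap :=
    (AffineSubspace.map_span φ.toAffineMap _).symm
  rw [h2, AffineSubspace.mem_map] at h1
  obtain ⟨t, ht, hts⟩ := h1
  rwa [← φ.injective hts]

theorem intrinsicInterior_eq_interior_of_affineSpan_eq_top {V : Type*} [NormedAddCommGroup V]
    [NormedSpace ℝ V] {s : Set V} (hs : affineSpan ℝ s = ⊤) :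
    intrinsicInterior ℝ s = interior s := by
  refine subset_antisymm ?_ interior_subset_intrinsicInterior
  rintro _ ⟨x, hx, rfl⟩
  have hopen : IsOpenMap ((↑) : affineSpan ℝ s → V) := by
    refine IsOpen.isOpenMap_subtype_val ?_
    rw [hs]
    exact isOpen_univ
  exact hopen.interior_preimage_subset_preimage_interior hx

theorem exists_ball_of_mem_intrinsicInterior {D : Set H} {y : H}
    (hy : y ∈ intrinsicInterior ℝ D) :
    ∃ (S : Submodule ℝ H) (ε : ℝ), 0 < ε ∧ (∀ d ∈ D, d - y ∈ S) ∧
      ∀ s ∈ S, ‖s‖ ≤ ε → y + s ∈ D := by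
  obtain ⟨S, x, φ, hφ, himage, hspan⟩ :=
    exists_affineIsometry_image_eq ⟨y, intrinsicInterior_subset hy⟩
  rw [← himage, AffineIsometry.intrinsicInterior_image,
    intrinsicInterior_eq_interior_of_affineSpan_eq_top hspan] at hy
  obtain ⟨z, hz, rfl⟩ := hy
  obtain ⟨ε, hε, hball⟩ := Metric.nhds_basis_closedBall.mem_iff.1 (mem_interior_iff_mem_nhds.1 hz)
  refine ⟨S, ε, hε, fun d hd => ?_, fun s hs hsε => ?_⟩
  · rw [← himage] at hd
    obtain ⟨t, -, rfl⟩ := hd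
    rw [hφ, hφ, add_sub_add_left_eq_sub]
    exact S.sub_mem t.2 z.2
  · have h : z + ⟨s, hs⟩ ∈ φ ⁻¹' D := hball (by simpa using hsε)
    simpa [hφ, add_assoc] using h

variable [FiniteDimensional ℝ H]

/-- A set between the relative interior and the closure of a convex set is nearly equal to it. -/
theorem nearlyEqual_of_subset_closure {C D : Set H} (hD : Convex ℝ D) (hne : D.Nonempty)
    (h1 : intrinsicInterior ℝ D ⊆ C) (h2 : C ⊆ closure D) : NearlyEqual C D := by
  obtain ⟨S, x, φ, hφ, himage, hspan⟩ := exists_affineIsometry_image_eq hne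
  have hemb : Topology.IsClosedEmbedding φ := φ.isometry.isClosedEmbedding
  have hD' : Convex ℝ (φ ⁻¹' D) := hD.affine_preimage φ.toAffineMap
  have hint : (interior (φ ⁻¹' D)).Nonempty := hD'.interior_nonempty_iff_affineSpan_eq_top.2 hspan
  have hclD : closure D = φ '' closure (φ ⁻¹' D) := by
    conv_lhs => rw [← himage]
    exact hemb.closure_image_eq _
  have hriD : intrinsicInterior ℝ D = φ '' interior (φ ⁻¹' D) := by
    conv_lhs => rw [← himage]
    rw [AffineIsometry.intrinsicInterior_image,
      intrinsicInterior_eq_interior_of_affineSpan_eq_top hspan]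
  have hC : φ '' (φ ⁻¹' C) = C := by
    rw [image_preimage_eq_iff]
    exact h2.trans (hclD ▸ image_subset_range _ _)
  have h1' : interior (φ ⁻¹' D) ⊆ φ ⁻¹' C := by
    rw [← image_subset_iff, ← hriD]
    exact h1
  have h2' : φ ⁻¹' C ⊆ closure (φ ⁻¹' D) := by
    rw [← hC, hclD] at h2
    exact (image_subset_image_iff φ.injective).1 h2
  -- A convex set with nonempty interior has the same interior as its closure.
  have hintC : interior (φ ⁻¹' C) = interior (φ ⁻¹' D) := by
    refine subset_antisymm ?_ (interior_maximal h1' isOpen_interior)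
    rw [← hD'.interior_closure_eq_interior_of_nonempty_interior hint]
    exact interior_mono h2'
  have hspanC : affineSpan ℝ (φ ⁻¹' C) = ⊤ :=
    affineSpan_eq_top_of_nonempty_interior
      ((hintC ▸ hint).mono (interior_mono (subset_convexHull ℝ _)))
  constructor
  · refine subset_antisymm (closure_minimal h2 isClosed_closure) ?_
    rw [hclD, ← hD'.closure_interior_eq_closure_of_nonempty_interior hint, ← hC,
      ← hemb.closure_image_eq]
    exact closure_mono (image_mono h1')
  · rw [hriD, ← hintC]
    conv_lhs => rw [← hC]
    rw [AffineIsometry.intrinsicInterior_image,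
      intrinsicInterior_eq_interior_of_affineSpan_eq_top hspanC]

end NearEquality

/-! ### The two inclusions for the displacement range -/

section DisplacementRange

variable {H : Type*} [NormedAddCommGroup H] [InnerProductSpace ℝ H] [CompleteSpace H]

theorem displacementRange_subset_add {f : H → ℝ} (hf : ConvexOn ℝ univ f)
    (hdiff : Differentiable ℝ f) {g : H → EReal} (hg : IsProperFun g) :
    displacementRange (forwardBackward (gradient f) (subdiff g)) ⊆
      minorantSlopes (epigraph fun x => (f x : EReal)) + minorantSlopes (epigraph g) := by
  intro y hy
  obtain ⟨x, hx⟩ := mem_displacementRange_forwardBackward_iff.1 hy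
  exact ⟨gradient f x, gradient_mem_minorantSlopes hf (hdiff x).hasGradientAt, _,
    (mem_minorantSlopes_of_mem_subdiff hg hx).1, add_sub_cancel _ _⟩

theorem intrinsicInterior_add_subset_displacementRange [FiniteDimensional ℝ H] {f : H → ℝ}
    (hf : ConvexOn ℝ univ f) (hdiff : Differentiable ℝ f) {g : H → EReal} (hconv : IsConvexFun g)
    (hlsc : LowerSemicontinuous g) (hg : IsProperFun g) :
    intrinsicInterior ℝ
        (minorantSlopes (epigraph fun x => (f x : EReal)) + minorantSlopes (epigraph g)) ⊆
      displacementRange (forwardBackward (gradient f) (subdiff g)) := by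
  intro y hy
  obtain ⟨S, ε, hε, hS, hball⟩ := exists_ball_of_mem_intrinsicInterior hy
  -- `∇ψ p = ∇f (p + y) - y`, so a zero `p` of `∇ψ + ∂g` solves the inclusion at `x = p + y`; the
  -- slopes of `ψ` are those of `f` minus `y`.
  set ψ : H → ℝ := fun x => f (x + y) - ⟪y, x⟫
  have hgrad : ∀ x, HasGradientAt ψ (gradient f (x + y) - y) x := fun x => by
    rw [hasGradientAt_iff_hasFDerivAt, map_sub]
    have h := (hdiff (x + y)).hasGradientAt.hasFDerivAt
    exact (h.comp x ((hasFDerivAt_id x).add_const y)).sub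
      (InnerProductSpace.toDual ℝ H y).hasFDerivAt
  have hψ : ConvexOn ℝ univ ψ := by
    have h := (hf.translate_left y).sub
      (LinearMap.concaveOn (InnerProductSpace.toDual ℝ H y).toLinearMap convex_univ)
    exact h.congr fun x _ => rfl
  have hslope : ∀ b, b ∈ minorantSlopes (epigraph fun x => (ψ x : EReal)) ↔
      b + y ∈ minorantSlopes (epigraph fun x => (f x : EReal)) := fun b => by
    rw [mem_minorantSlopes_coe, mem_minorantSlopes_coe]
    constructor
    · rintro ⟨c, hc⟩
      refine ⟨c + ⟪b + y, y⟫, fun x => ?_⟩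
      have h := hc (x - y)
      simp only [ψ, sub_add_cancel, inner_sub_right] at h
      simp only [inner_add_left]
      linarith
    · rintro ⟨c, hc⟩
      refine ⟨c - ⟪b + y, y⟫, fun x => ?_⟩
      have h := hc (x + y)
      simp only [inner_add_left, inner_add_right] at h
      simp only [ψ, inner_add_left]
      linarith
  obtain ⟨p, hp⟩ := exists_neg_gradient_mem_subdiff hψ (fun x => (hgrad x).differentiableAt)
    hconv hlsc hg S (by
      rintro _ ⟨a, ha, b, hb, rfl⟩
      have h := hS _ (add_mem_add ((hslope a).1 ha) hb)
      rwa [show a + y + b - y = a + b by abel] at h) hε (fun s hs hsε => by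
      obtain ⟨a, ha, b, hb, hab⟩ := hball s hs hsε
      simp only at hab
      refine ⟨a - y, (hslope _).2 (by rwa [sub_add_cancel]), b, hb, ?_⟩
      simp only
      rw [sub_add_eq_add_sub, hab, add_sub_cancel_left])
  refine mem_displacementRange_forwardBackward_iff.2 ⟨p + y, ?_⟩
  rw [add_sub_cancel_right]
  rwa [(hgrad p).gradient, neg_sub] at hp

end DisplacementRange

/-! ### Barrier cone and recession cone -/

section Recession

variable {H : Type*} [NormedAddCommGroup H] [InnerProductSpace ℝ H]

theorem mem_minorantSlopes_indicatorFun {V : Set H} {b : H} :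
    b ∈ minorantSlopes (epigraph (indicatorFun V)) ↔ ∃ c : ℝ, ∀ v ∈ V, ⟪b, v⟫ ≤ c := by
  refine exists_congr fun c => ⟨fun h v hv => ?_, fun h p hp => ?_⟩
  · have := h (v, 0) (show indicatorFun V v ≤ _ by simp [indicatorFun, hv])
    simpa using this
  · have h1 : indicatorFun V p.1 ≤ (p.2 : EReal) := hp
    by_cases hpV : p.1 ∈ V
    · have h2 : (0 : ℝ) ≤ p.2 := by simpa [indicatorFun, hpV] using h1
      linarith [h _ hpV]
    · simp [indicatorFun, hpV] at h1

/-- The barrier cone of a nonempty set is contained in the polar of its recession cone. -/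
theorem minorantSlopes_indicatorFun_subset {V : Set H} (hV : V.Nonempty) :
    minorantSlopes (epigraph (indicatorFun V)) ⊆ polarCone (recessionCone V) := by
  intro b hb r hr
  obtain ⟨c, hc⟩ := mem_minorantSlopes_indicatorFun.1 hb
  obtain ⟨v, hv⟩ := hV
  have hmem : ∀ n : ℕ, n • r + v ∈ V := fun n => by
    induction n with
    | zero => simpa using hv
    | succ n ih =>
      rw [succ_nsmul', add_assoc]
      exact hr _ ih
  rw [real_inner_comm]
  by_contra! hpos
  obtain ⟨n, hn⟩ := exists_nat_gt ((c - ⟪b, v⟫) / ⟪b, r⟫)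
  rw [div_lt_iff₀ hpos] at hn
  have h := hc _ (hmem n)
  rw [← Nat.cast_smul_eq_nsmul ℝ, inner_add_right, real_inner_smul_right] at h
  linarith

/-- The barrier cone of a closed convex set is dense in the polar of its recession cone. -/
theorem polarCone_recessionCone_subset_closure [CompleteSpace H] {V : Set H}
    (hclosed : IsClosed V) (hconv : Convex ℝ V) :
    polarCone (recessionCone V) ⊆ closure (minorantSlopes (epigraph (indicatorFun V))) := by
  intro u hu
  by_contra hnot
  obtain ⟨F, α, h1, h2⟩ := geometric_hahn_banach_closed_point
    (convex_minorantSlopes _).closure isClosed_closure hnot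
  set r : H := (InnerProductSpace.toDual ℝ H).symm F
  have hF : ∀ x, F x = ⟪r, x⟫ := fun x => by simp [r]
  have hα : 0 < α := by
    simpa using h1 0 (subset_closure (mem_minorantSlopes_indicatorFun.2 ⟨0, by simp⟩))
  -- The slopes form a cone: were `⟪b, r⟫` positive, the multiple of `b` by `α / ⟪b, r⟫` would
  -- attain the strict bound `α`.
  have hneg : ∀ b ∈ minorantSlopes (epigraph (indicatorFun V)), ⟪b, r⟫ ≤ 0 := by
    intro b hb
    obtain ⟨c, hc⟩ := mem_minorantSlopes_indicatorFun.1 hb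
    by_contra! hpos
    have h3 := h1 ((α / ⟪b, r⟫) • b) (subset_closure (mem_minorantSlopes_indicatorFun.2
      ⟨α / ⟪b, r⟫ * c, fun v hv => by
        rw [real_inner_smul_left]
        exact mul_le_mul_of_nonneg_left (hc v hv) (div_pos hα hpos).le⟩))
    rw [hF, real_inner_smul_right, real_inner_comm b r, div_mul_cancel₀ _ hpos.ne'] at h3
    exact lt_irrefl _ h3
  -- A functional `b` separating `r + v` from `V` is bounded above on `V`, so `⟪b, r⟫ ≤ 0`,
  -- contradicting `⟪b, v⟫ < β < ⟪b, r + v⟫`.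
  have hrec : r ∈ recessionCone V := by
    intro v hv
    by_contra hrv
    obtain ⟨G, β, h3, h4⟩ := geometric_hahn_banach_closed_point hconv hclosed hrv
    set b : H := (InnerProductSpace.toDual ℝ H).symm G
    have hG : ∀ x, G x = ⟪b, x⟫ := fun x => by simp [b]
    have h5 := hneg b (mem_minorantSlopes_indicatorFun.2
      ⟨β, fun w hw => by rw [← hG]; exact (h3 w hw).le⟩)
    have h6 := h3 v hv
    rw [hG] at h4 h6
    rw [inner_add_right] at h4
    linarith
  have h3 := hu r hrec
  rw [hF] at h2
  linarith

theorem NearlyEqual.symm {C D : Set H} (h : NearlyEqual C D) : NearlyEqual D C :=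
  ⟨h.1.symm, h.2.symm⟩

theorem NearlyEqual.trans {C D E : Set H} (h : NearlyEqual C D) (h' : NearlyEqual D E) :
    NearlyEqual C E :=
  ⟨h.1.trans h'.1, h.2.trans h'.2⟩

end Recession

end ConvexFB

/-! ### The main theorem -/

theorem mainTheorem5 {H : Type*} [NormedAddCommGroup H] [InnerProductSpace ℝ H]
    [CompleteSpace H] [FiniteDimensional ℝ H]
    (f : H → ℝ) (hf_conv : ConvexOn ℝ Set.univ f) (hf_diff : Differentiable ℝ f)
    (hf_nonexp : LipschitzWith 1 (gradient f))
    (g : H → EReal) (hg_conv : ConvexFB.IsConvexFun g) (hg_lsc : LowerSemicontinuous g)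
    (hg_proper : ConvexFB.IsProperFun g) :
    (∀ x : H, ∃! p : H,
      p ∈ ConvexFB.forwardBackward (gradient f) (ConvexFB.subdiff g) x) ∧
    ConvexFB.NearlyEqual
      (ConvexFB.displacementRange
        (ConvexFB.forwardBackward (gradient f) (ConvexFB.subdiff g)))
      (ConvexFB.effDomain (ConvexFB.fenchelConj (fun x => (f x : EReal))) +
        ConvexFB.effDomain (ConvexFB.fenchelConj g)) ∧
    (∀ V : Set H, V.Nonempty → IsClosed V → Convex ℝ V → g = ConvexFB.indicatorFun V →
      ConvexFB.NearlyEqual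
        (ConvexFB.displacementRange
          (ConvexFB.forwardBackward (gradient f) (ConvexFB.subdiff g)))
        (ConvexFB.effDomain (ConvexFB.fenchelConj (fun x => (f x : EReal))) +
          ConvexFB.polarCone (ConvexFB.recessionCone V))) := by
  have hf_slopes : ConvexFB.effDomain (ConvexFB.fenchelConj (fun x => (f x : EReal))) =
      ConvexFB.minorantSlopes (ConvexFB.epigraph fun x => (f x : EReal)) :=
    Set.ext fun _ => ConvexFB.mem_effDomain_fenchelConj_iff fun _ => EReal.coe_ne_bot _
  have hg_slopes : ConvexFB.effDomain (ConvexFB.fenchelConj g) =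
      ConvexFB.minorantSlopes (ConvexFB.epigraph g) :=
    Set.ext fun _ => ConvexFB.mem_effDomain_fenchelConj_iff hg_proper.1
  have hconv := (ConvexFB.convex_minorantSlopes
    (ConvexFB.epigraph fun x => (f x : EReal))).add
      (ConvexFB.convex_minorantSlopes (ConvexFB.epigraph g))
  have hne : (ConvexFB.minorantSlopes (ConvexFB.epigraph fun x => (f x : EReal)) +
      ConvexFB.minorantSlopes (ConvexFB.epigraph g)).Nonempty :=
    Set.Nonempty.add
      ⟨_, ConvexFB.gradient_mem_minorantSlopes hf_conv (hf_diff 0).hasGradientAt⟩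
      (ConvexFB.nonempty_minorantSlopes_epigraph hg_conv hg_lsc hg_proper)
  have hmain : ConvexFB.NearlyEqual
      (ConvexFB.displacementRange
        (ConvexFB.forwardBackward (gradient f) (ConvexFB.subdiff g)))
      (ConvexFB.minorantSlopes (ConvexFB.epigraph fun x => (f x : EReal)) +
        ConvexFB.minorantSlopes (ConvexFB.epigraph g)) :=
    ConvexFB.nearlyEqual_of_subset_closure hconv hne
      (ConvexFB.intrinsicInterior_add_subset_displacementRange hf_conv hf_diff hg_conv hg_lsc
        hg_proper)
      ((ConvexFB.displacementRange_subset_add hf_conv hf_diff hg_proper).trans subset_closure)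
  rw [hf_slopes, hg_slopes]
  refine ⟨fun x => ConvexFB.existsUnique_mem_opResolvent_subdiff hg_conv hg_lsc hg_proper _,
    hmain, fun V hV hV_closed hV_conv hgV => hmain.trans (ConvexFB.NearlyEqual.symm ?_)⟩
  subst hgV
  -- The sum with the polar cone is sandwiched between `dom f* + dom g*` and its closure.
  refine ConvexFB.nearlyEqual_of_subset_closure hconv hne
    (intrinsicInterior_subset.trans
      (Set.add_subset_add_left (ConvexFB.minorantSlopes_indicatorFun_subset hV))) ?_
  rintro _ ⟨a, ha, u, hu, rfl⟩
  exact map_mem_closure (continuous_const_add a)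
    (ConvexFB.polarCone_recessionCone_subset_closure hV_closed hV_conv hu)
    fun b hb => Set.add_mem_add ha hb
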